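/- Let $d\in\{1,2\}$ and let $S_d^+$ be the cone of symmetric positive semi-definite real $d\times d$ matrices. Let $p\ge 0$ and let $\omega,\sigma\in S_d^+$ with $\sigma$ invertible; if $d=1$, assume in addition that $(p,\omega)\neq(0,0)$. Then the following are equivalent. 1. There exists a Borel probability measure $\Gamma(p,\omega;\sigma)$ on $S_d^+$, different from the point mass at $0$, whose Laplace transform is $$\int_{S_d^+} e^{-\operatorname{tr}(u\xi)}\,\Gamma(p,\omega;\sigma)(d\xi)=\bigl(\det(I+\sigma u)\bigr)^{-p}\,e^{-\operatorname{tr}\left(u(I+\sigma u)^{-1}\omega\right)}\qquad\text{for all }u\in S_d^+ .$$ 2. $p\in\Lambda_d$, where $\Lambda_d=\{\tfrac j2 : j=1,2,\dots,d-2\}\cup[\tfrac{d-1}{2},\infty)$ is the Gindikin ensemble; that is, $\Lambda_1=[0,\infty)$ and $\Lambda_2=[\tfrac12,\infty)$. -/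

import Mathlib

open MeasureTheory

noncomputable section

/-- The cone `S_d^+` of symmetric positive semi-definite real `d × d` matrices, with the topology
and the Borel `σ`-algebra inherited from the space of matrices. -/
abbrev PSDCone (d : ℕ) : Type :=
  {A : Matrix (Fin d) (Fin d) ℝ // A.PosSemidef}

instance PSDCone.instZero (d : ℕ) : Zero (PSDCone d) :=
  ⟨⟨0, Matrix.PosSemidef.zero⟩⟩

instance PSDCone.instMeasurableSpace (d : ℕ) : MeasurableSpace (PSDCone d) :=
  borel (PSDCone d)

instance PSDCone.instBorelSpace (d : ℕ) : BorelSpace (PSDCone d) :=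
  ⟨rfl⟩

/-- The Laplace transform of a measure on the cone, with respect to the pairing `tr (u ξ)`. The
integrand takes values in `(0, 1]` for `u` in the cone, so it is integrable for finite `μ`. -/
def laplaceTransform {d : ℕ} (μ : Measure (PSDCone d)) (u : PSDCone d) : ℝ :=
  ∫ ξ, Real.exp (-(u.1 * ξ.1).trace) ∂μ

/-- The function `u ↦ det(I + σ u)^{-p} exp(-tr(u (I + σ u)⁻¹ ω))`. -/
def wishartLaplace {d : ℕ} (p : ℝ) (ω σ : PSDCone d) (u : PSDCone d) : ℝ :=
  (1 + σ.1 * u.1).det ^ (-p) * Real.exp (-(u.1 * (1 + σ.1 * u.1)⁻¹ * ω.1).trace)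

/-- `μ` is the non-central Wishart distribution `Γ(p, ω; σ)`. -/
structure IsNoncentralWishart {d : ℕ} (p : ℝ) (ω σ : PSDCone d)
    (μ : Measure (PSDCone d)) : Prop where
  isProbabilityMeasure : IsProbabilityMeasure μ
  laplaceTransform_eq : ∀ u : PSDCone d, laplaceTransform μ u = wishartLaplace p ω σ u

/-- The Gindikin ensemble `Λ_d = {j/2 : j = 1, …, d - 2} ∪ [(d - 1)/2, ∞)`. -/
def gindikinEnsemble (d : ℕ) : Set ℝ :=
  {x | ∃ j : ℕ, 1 ≤ j ∧ j + 2 ≤ d ∧ x = (j : ℝ) / 2} ∪ Set.Ici (((d : ℝ) - 1) / 2)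

theorem gindikinEnsemble_one : gindikinEnsemble 1 = Set.Ici 0 := by
  ext x
  simp [gindikinEnsemble]

theorem gindikinEnsemble_two : gindikinEnsemble 2 = Set.Ici (1 / 2) := by
  ext x
  simp only [gindikinEnsemble, Set.mem_union, Set.mem_ofPred_eq, Set.mem_Ici]
  constructor
  · rintro (⟨j, h1, h2, -⟩ | h)
    · omega
    · norm_num at h ⊢
      exact h
  · intro h
    right
    norm_num at h ⊢
    exact h

end

/-! A congruence `ξ ↦ B ξ Bᵀ` with `B Bᵀ = σ` reduces everything to `σ = I`.

Sufficiency. For `d = 1` the law is a Poisson mixture of gamma laws, for every `p ≥ 0`. For `d = 2`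
it is composed of two transitions with the degenerate scales `diag(1,0)` and `diag(0,1)`; their
Laplace exponents compose because `u ↦ u(I + σu)⁻¹` is additive in `σ`. Each transition keeps one
diagonal entry, moves the Schur complement of that entry by a non-central gamma law of shape `p -
1/2`, and moves the remaining coordinate by a Gaussian of variance `1/2`. The shape must be
nonnegative, which is the condition `p ≥ 1/2` (`exists_isNoncentralWishart_fin_two`).

Necessity for `d = 2`. Since `det ξ ≥ 0` on the cone, `∫ det ξ e^{-t tr ξ} dμ ≥ 0`. As `4 det ξ =
(tr ξ)² - (ξ₁₁ - ξ₂₂)² - (2ξ₁₂)²`, this integral is read off from second derivatives of the Laplace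
transform at `tI`. The outcome (`IsNoncentralWishart.det_moment_nonneg`) fails for large `t` when `0
< p < 1/2`. When `p = 0` it forces `ω = 0`, and then `μ` is the point mass at `0`. -/

open ProbabilityTheory
open scoped NNReal ENNReal

noncomputable section

/-! ### One-dimensional laws -/

/-- The gamma law with shape `q ≥ 0` and rate `1`; it is the point mass at `0` for `q = 0`. -/
def gammaLaw (q : ℝ) : Measure ℝ :=
  if q = 0 then Measure.dirac 0 else gammaMeasure q 1

theorem measurable_gammaPDF (a r : ℝ) : Measurable (gammaPDF a r) :=
  (measurable_gammaPDFReal a r).ennreal_ofReal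

/-- Exponential tilting turns the density of rate `1` into that of rate `1 + a`, up to the stated
factor. -/
theorem lintegral_exp_neg_gammaLaw {q a : ℝ} (hq : 0 ≤ q) (ha : 0 ≤ a) :
    ∫⁻ x, ENNReal.ofReal (Real.exp (-(a * x))) ∂gammaLaw q = ENNReal.ofReal ((1 + a) ^ (-q)) := by
  unfold gammaLaw
  split_ifs with h
  · subst h
    rw [lintegral_dirac' _ (by fun_prop)]
    simp
  · have hq' : 0 < q := lt_of_le_of_ne hq (Ne.symm h)
    have ha' : 0 < 1 + a := by linarith
    rw [gammaMeasure, lintegral_withDensity_eq_lintegral_mul _ (measurable_gammaPDF _ _)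
      (by fun_prop)]
    have : ∀ x, (gammaPDF q 1 * fun x => ENNReal.ofReal (Real.exp (-(a * x)))) x
        = ENNReal.ofReal ((1 + a) ^ (-q)) * gammaPDF q (1 + a) x := by
      intro x
      simp only [Pi.mul_apply, gammaPDF]
      rw [← ENNReal.ofReal_mul (gammaPDFReal_nonneg hq' one_pos x),
        ← ENNReal.ofReal_mul (by positivity)]
      congr 1
      unfold gammaPDFReal
      split_ifs with hx
      · have h1 : Real.exp (-((1 + a) * x)) = Real.exp (-(1 * x)) * Real.exp (-(a * x)) := by
          rw [← Real.exp_add]; ring_nf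
        rw [h1, Real.rpow_neg ha'.le, Real.one_rpow]
        have := (Real.rpow_pos_of_pos ha' q).ne'
        field_simp
      · simp
    simp_rw [this]
    rw [lintegral_const_mul _ (measurable_gammaPDF _ _), lintegral_gammaPDF_eq_one hq' ha',
      mul_one]

theorem gammaLaw_ae_nonneg (q : ℝ) : ∀ᵐ x ∂gammaLaw q, 0 ≤ x := by
  unfold gammaLaw
  split_ifs with h
  · rw [ae_dirac_iff measurableSet_Ici]
  · rw [gammaMeasure, ae_withDensity_iff (measurable_gammaPDF _ _)]
    refine ae_of_all _ fun x hx => ?_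
    by_contra hneg
    exact hx (gammaPDF_of_neg (not_le.mp hneg))

/-- The non-central gamma law: the mixture of the laws `gammaLaw (p + k)` over a Poisson
variable `k` with mean `w`. -/
def noncentralGamma (p : ℝ) (w : ℝ≥0) : Measure ℝ :=
  Measure.sum fun k : ℕ =>
    ENNReal.ofReal (Real.exp (-w) * w ^ k / k.factorial) • gammaLaw (p + k)

/-- The `k`-th term contributes `(w / (1 + a))^k / k!`, so the sum is an exponential series, and `w
/ (1 + a) - w = -(a w / (1 + a))`. -/
theorem lintegral_exp_neg_noncentralGamma {p a : ℝ} (w : ℝ≥0) (hp : 0 ≤ p) (ha : 0 ≤ a) :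
    ∫⁻ x, ENNReal.ofReal (Real.exp (-(a * x))) ∂noncentralGamma p w =
      ENNReal.ofReal ((1 + a) ^ (-p) * Real.exp (-(a * w / (1 + a)))) := by
  have ha' : 0 < 1 + a := by linarith
  rw [noncentralGamma, lintegral_sum_measure]
  have hterm : ∀ k : ℕ, ∫⁻ x, ENNReal.ofReal (Real.exp (-(a * x)))
        ∂(ENNReal.ofReal (Real.exp (-w) * w ^ k / k.factorial) • gammaLaw (p + k)) =
      ENNReal.ofReal ((1 + a) ^ (-p) * Real.exp (-w) *
        (((w : ℝ) / (1 + a)) ^ k / k.factorial)) := by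
    intro k
    rw [lintegral_smul_measure, lintegral_exp_neg_gammaLaw (by positivity) ha, smul_eq_mul,
      ← ENNReal.ofReal_mul (by positivity)]
    congr 1
    rw [neg_add, Real.rpow_add ha', Real.rpow_neg ha'.le (k : ℝ), Real.rpow_natCast, div_pow]
    field_simp
  simp_rw [hterm]
  have hs : HasSum (fun k : ℕ => (1 + a) ^ (-p) * Real.exp (-w) *
      (((w : ℝ) / (1 + a)) ^ k / k.factorial))
      ((1 + a) ^ (-p) * Real.exp (-w) * Real.exp ((w : ℝ) / (1 + a))) := by
    refine HasSum.mul_left _ ?_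
    have := NormedSpace.expSeries_div_hasSum_exp ((w : ℝ) / (1 + a))
    rwa [← Real.exp_eq_exp_ℝ] at this
  rw [← ENNReal.ofReal_tsum_of_nonneg (fun k => by positivity) hs.summable, hs.tsum_eq, mul_assoc,
    ← Real.exp_add]
  congr 3
  field_simp
  ring

theorem noncentralGamma_ae_nonneg (p : ℝ) (w : ℝ≥0) : ∀ᵐ x ∂noncentralGamma p w, 0 ≤ x := by
  rw [noncentralGamma, Measure.ae_sum_iff]
  exact fun k => Measure.ae_smul_measure (gammaLaw_ae_nonneg _) _

theorem isProbabilityMeasure_noncentralGamma {p : ℝ} (hp : 0 ≤ p) (w : ℝ≥0) :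
    IsProbabilityMeasure (noncentralGamma p w) :=
  ⟨by simpa using lintegral_exp_neg_noncentralGamma w hp le_rfl⟩

theorem measurable_noncentralGamma (p : ℝ) : Measurable (noncentralGamma p) := by
  refine Measure.measurable_of_measurable_coe _ fun s hs => ?_
  simp only [noncentralGamma, Measure.sum_apply _ hs, Measure.smul_apply, smul_eq_mul]
  refine Measurable.tsum fun k => ?_
  fun_prop

theorem lintegral_exp_neg_gaussianReal {a : ℝ} (ha : 0 ≤ a) (q b : ℝ) :
    ∫⁻ x, ENNReal.ofReal (Real.exp (-(a * (q + x) ^ 2 + 2 * b * (q + x))))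
        ∂gaussianReal 0 (1 / 2) =
      ENNReal.ofReal ((1 + a) ^ (-(1 / 2 : ℝ)) * Real.exp ((q - b) ^ 2 / (1 + a) - q ^ 2)) := by
  have ha' : 0 < 1 + a := by linarith
  -- Completing the square gives a Gaussian density of variance `v` and mean `-(a q + b) / (1 + a)`.
  obtain ⟨v, hv⟩ : ∃ v : ℝ≥0, (v : ℝ) = 1 / (2 * (1 + a)) := ⟨⟨_, by positivity⟩, rfl⟩
  have hv0 : v ≠ 0 := by
    rintro rfl
    have : 0 < 1 / (2 * (1 + a)) := by positivity
    rw [← hv] at this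
    simp at this
  rw [gaussianReal_of_var_ne_zero _ (by norm_num),
    lintegral_withDensity_eq_lintegral_mul _ (by fun_prop) (by fun_prop)]
  have : ∀ x, (gaussianPDF 0 (1 / 2) *
      fun x => ENNReal.ofReal (Real.exp (-(a * (q + x) ^ 2 + 2 * b * (q + x))))) x =
      ENNReal.ofReal ((1 + a) ^ (-(1 / 2 : ℝ)) * Real.exp ((q - b) ^ 2 / (1 + a) - q ^ 2)) *
        gaussianPDF (-(a * q + b) / (1 + a)) v x := by
    intro x
    simp only [Pi.mul_apply, gaussianPDF]
    rw [← ENNReal.ofReal_mul (gaussianPDFReal_nonneg _ _ _), ← ENNReal.ofReal_mul (by positivity)]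
    congr 1
    simp only [gaussianPDFReal, hv]
    have hs : (√(2 * Real.pi * (1 / (2 * (1 + a)))))⁻¹ = (√Real.pi)⁻¹ * (1 + a) ^ (1 / 2 : ℝ) := by
      rw [show 2 * Real.pi * (1 / (2 * (1 + a))) = Real.pi / (1 + a) by field_simp,
        Real.sqrt_div' _ ha'.le, inv_div, Real.sqrt_eq_rpow (1 + a)]
      ring
    have hs' : (√(2 * Real.pi * ((1 / 2 : ℝ≥0) : ℝ)))⁻¹ = (√Real.pi)⁻¹ := by
      congr 2; push_cast; ring
    rw [hs, hs', Real.rpow_neg ha'.le, mul_assoc, ← Real.exp_add]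
    have : (1 + a) ^ (1 / 2 : ℝ) ≠ 0 := (Real.rpow_pos_of_pos ha' _).ne'
    rw [show ∀ c e d f : ℝ, c⁻¹ * e * (d * c * f) = (c⁻¹ * c) * (d * (e * f)) by intros; ring,
      inv_mul_cancel₀ this, one_mul, ← Real.exp_add]
    congr 2
    push_cast
    field_simp
    ring
  simp_rw [this]
  rw [lintegral_const_mul _ (by fun_prop), lintegral_gaussianPDF_eq_one _ hv0, mul_one]

/-! ### Congruences of the cone -/

/-- Lower integrals need no integrability, and `u = 0` already gives total mass `1`. -/
theorem IsNoncentralWishart.ext_lintegral {d : ℕ} {p : ℝ} {ω σ : PSDCone d}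
    {μ : Measure (PSDCone d)}
    (h : ∀ u : PSDCone d, ∫⁻ ξ, ENNReal.ofReal (Real.exp (-(u.1 * ξ.1).trace)) ∂μ =
      ENNReal.ofReal (wishartLaplace p ω σ u)) (hpos : ∀ u, 0 ≤ wishartLaplace p ω σ u) :
    IsNoncentralWishart p ω σ μ where
  isProbabilityMeasure := by
    refine ⟨?_⟩
    have h0 := h 0
    have hz : (0 : PSDCone d).1 = 0 := rfl
    simpa [wishartLaplace, hz] using h0
  laplaceTransform_eq u := by
    have hc : Continuous fun ξ : PSDCone d => Real.exp (-(u.1 * ξ.1).trace) := by fun_prop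
    rw [laplaceTransform, integral_eq_lintegral_of_nonneg_ae
      (ae_of_all _ fun ξ => (Real.exp_pos _).le) hc.measurable.aestronglyMeasurable, h u,
      ENNReal.toReal_ofReal (hpos u)]

/-- The congruence `ξ ↦ B ξ Bᵀ` of the cone. -/
def PSDCone.congruence {d : ℕ} (B : Matrix (Fin d) (Fin d) ℝ) (ξ : PSDCone d) : PSDCone d :=
  ⟨B * ξ.1 * B.transpose, ξ.2.mul_mul_conjTranspose_same B⟩

theorem PSDCone.measurable_congruence {d : ℕ} (B : Matrix (Fin d) (Fin d) ℝ) :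
    Measurable (PSDCone.congruence B) := by
  refine Continuous.measurable ?_
  unfold PSDCone.congruence
  fun_prop

theorem PSDCone.congruence_zero {d : ℕ} (B : Matrix (Fin d) (Fin d) ℝ) :
    PSDCone.congruence B 0 = 0 := by
  refine Subtype.ext ?_
  have hz : (0 : PSDCone d).1 = 0 := rfl
  simp [PSDCone.congruence, hz]

theorem PSDCone.congruence_congruence {d : ℕ} {A B : Matrix (Fin d) (Fin d) ℝ} (h : A * B = 1)
    (ξ : PSDCone d) : PSDCone.congruence A (PSDCone.congruence B ξ) = ξ := by
  refine Subtype.ext ?_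
  simp only [PSDCone.congruence]
  calc A * (B * ξ.1 * B.transpose) * A.transpose
      = (A * B) * ξ.1 * (A * B).transpose := by
        rw [Matrix.transpose_mul]; simp only [Matrix.mul_assoc]
    _ = ξ.1 := by simp [h]

/-- `det(1 + XY) = det(1 + YX)` handles the determinant; conjugation by `B` and cyclicity of the
trace handle the exponent. -/
theorem wishartLaplace_congruence {d : ℕ} (p : ℝ) (ω σ u : PSDCone d)
    (B : Matrix (Fin d) (Fin d) ℝ) (hB : IsUnit B) :
    wishartLaplace p (PSDCone.congruence B ω) (PSDCone.congruence B σ) u =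
      wishartLaplace p ω σ (PSDCone.congruence B.transpose u) := by
  obtain ⟨C, hC⟩ := hB.exists_left_inv
  have hC' := mul_eq_one_comm.mp hC
  simp only [wishartLaplace, PSDCone.congruence, Matrix.transpose_transpose]
  have hdet : (1 + B * σ.1 * B.transpose * u.1).det =
      (1 + σ.1 * (B.transpose * u.1 * B)).det := by
    rw [Matrix.mul_assoc, Matrix.mul_assoc, Matrix.det_one_add_mul_comm]
    simp only [Matrix.mul_assoc]
  have hinv : (1 + B * σ.1 * B.transpose * u.1)⁻¹ =
      B * (1 + σ.1 * (B.transpose * u.1 * B))⁻¹ * C := by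
    have : 1 + B * σ.1 * B.transpose * u.1 =
        B * (1 + σ.1 * (B.transpose * u.1 * B)) * C := by
      calc _ = B * C + B * σ.1 * B.transpose * u.1 * (B * C) := by rw [hC']; simp
        _ = _ := by simp only [Matrix.mul_add, Matrix.add_mul, Matrix.mul_assoc, Matrix.mul_one]
    rw [this, Matrix.mul_inv_rev, Matrix.mul_inv_rev, Matrix.inv_eq_left_inv hC,
      Matrix.inv_eq_left_inv hC', ← Matrix.mul_assoc]
  rw [hdet, hinv]
  congr 3
  calc (u.1 * (B * (1 + σ.1 * (B.transpose * u.1 * B))⁻¹ * C) * (B * ω.1 * B.transpose)).trace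
      = (u.1 * B * (1 + σ.1 * (B.transpose * u.1 * B))⁻¹ * (C * B) * ω.1 * B.transpose).trace := by
        simp only [Matrix.mul_assoc]
    _ = _ := by
        rw [hC, Matrix.mul_one, Matrix.trace_mul_comm]
        simp only [Matrix.mul_assoc]

theorem IsNoncentralWishart.map_congruence {d : ℕ} {p : ℝ} {ω σ : PSDCone d}
    {μ : Measure (PSDCone d)} (h : IsNoncentralWishart p ω σ μ)
    (B : Matrix (Fin d) (Fin d) ℝ) (hB : IsUnit B) :
    IsNoncentralWishart p (PSDCone.congruence B ω) (PSDCone.congruence B σ)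
      (μ.map (PSDCone.congruence B)) where
  isProbabilityMeasure :=
    have := h.isProbabilityMeasure
    Measure.isProbabilityMeasure_map (PSDCone.measurable_congruence B).aemeasurable
  laplaceTransform_eq u := by
    have hc : Continuous fun ξ : PSDCone d => Real.exp (-(u.1 * ξ.1).trace) := by fun_prop
    rw [wishartLaplace_congruence _ _ _ _ _ hB, ← h.laplaceTransform_eq, laplaceTransform,
      laplaceTransform, integral_map (PSDCone.measurable_congruence B).aemeasurable
        hc.measurable.aestronglyMeasurable]
    refine integral_congr_ae (ae_of_all _ fun ξ => ?_)
    simp only [PSDCone.congruence, Matrix.transpose_transpose]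
    congr 2
    rw [← Matrix.mul_assoc, Matrix.trace_mul_comm]
    simp only [Matrix.mul_assoc]

theorem exists_isNoncentralWishart_congruence {d : ℕ} {p : ℝ} {ω σ : PSDCone d}
    (B : Matrix (Fin d) (Fin d) ℝ) (hB : IsUnit B)
    (h : ∃ μ : Measure (PSDCone d), IsNoncentralWishart p ω σ μ ∧ μ ≠ Measure.dirac 0) :
    ∃ μ : Measure (PSDCone d), IsNoncentralWishart p (PSDCone.congruence B ω)
      (PSDCone.congruence B σ) μ ∧ μ ≠ Measure.dirac 0 := by
  obtain ⟨μ, hμ, hne⟩ := h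
  obtain ⟨C, hC⟩ := hB.exists_left_inv
  refine ⟨_, hμ.map_congruence B hB, fun h0 => hne ?_⟩
  have h1 := congrArg (Measure.map (PSDCone.congruence C)) h0
  rw [Measure.map_map (PSDCone.measurable_congruence C) (PSDCone.measurable_congruence B),
    Measure.map_dirac' (PSDCone.measurable_congruence C), PSDCone.congruence_zero] at h1
  rwa [show PSDCone.congruence C ∘ PSDCone.congruence B = id from
    funext (PSDCone.congruence_congruence hC), Measure.map_id] at h1

/-- The identity matrix as an element of the cone. -/
def PSDCone.one (d : ℕ) : PSDCone d := ⟨1, Matrix.PosSemidef.one⟩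

open scoped MatrixOrder Matrix.Norms.L2Operator in
theorem PSDCone.exists_congruence_one_eq {d : ℕ} (σ : PSDCone d) (hσ : IsUnit σ.1) :
    ∃ B : Matrix (Fin d) (Fin d) ℝ, IsUnit B ∧ PSDCone.congruence B (PSDCone.one d) = σ := by
  obtain ⟨B, hB⟩ := CStarAlgebra.nonneg_iff_eq_star_mul_self.mp σ.2.nonneg
  rw [hB, Matrix.isUnit_iff_isUnit_det, Matrix.det_mul] at hσ
  refine ⟨B.transpose, ?_, Subtype.ext ?_⟩
  · rw [Matrix.isUnit_iff_isUnit_det, Matrix.det_transpose]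
    exact isUnit_of_mul_isUnit_right hσ
  · simp [PSDCone.congruence, PSDCone.one, hB, Matrix.star_eq_conjTranspose]

/-- The scale parameter can be normalised to the identity. -/
theorem exists_isNoncentralWishart_iff_one {d : ℕ} (p : ℝ) (ω σ : PSDCone d) (hσ : IsUnit σ.1) :
    ∃ ω' : PSDCone d, (ω' = 0 ↔ ω = 0) ∧
      ((∃ μ : Measure (PSDCone d), IsNoncentralWishart p ω σ μ ∧ μ ≠ Measure.dirac 0) ↔
        ∃ μ : Measure (PSDCone d),
          IsNoncentralWishart p ω' (PSDCone.one d) μ ∧ μ ≠ Measure.dirac 0) := by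
  obtain ⟨B, hB, hBσ⟩ := PSDCone.exists_congruence_one_eq σ hσ
  obtain ⟨C, hC⟩ := hB.exists_left_inv
  have hC' := mul_eq_one_comm.mp hC
  have hCu : IsUnit C := IsUnit.of_mul_eq_one B hC
  have hBω : PSDCone.congruence B (PSDCone.congruence C ω) = ω :=
    PSDCone.congruence_congruence hC' ω
  refine ⟨PSDCone.congruence C ω, ⟨fun h => ?_, fun h => ?_⟩, fun h => ?_, fun h => ?_⟩
  · rw [← hBω, h, PSDCone.congruence_zero]
  · rw [h, PSDCone.congruence_zero]
  · have := exists_isNoncentralWishart_congruence C hCu h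
    rwa [← hBσ, PSDCone.congruence_congruence hC] at this
  · have := exists_isNoncentralWishart_congruence B hB h
    rwa [hBσ, hBω] at this

/-! ### Existence -/

/-- At `u = I` the transform is `2^{-dp} e^{-tr ω / 2}`, which is below `1` unless `p = 0` and `ω =
0`. -/
theorem IsNoncentralWishart.ne_dirac_zero {d : ℕ} (hd : 1 ≤ d) {p : ℝ} (hp : 0 ≤ p)
    {ω : PSDCone d} {μ : Measure (PSDCone d)} (h : IsNoncentralWishart p ω (PSDCone.one d) μ)
    (hpω : p = 0 → ω ≠ 0) : μ ≠ Measure.dirac 0 := by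
  rintro rfl
  have h1 := h.laplaceTransform_eq (PSDCone.one d)
  have hc : Continuous fun ξ : PSDCone d => Real.exp (-((PSDCone.one d).1 * ξ.1).trace) := by
    fun_prop
  have h2 : (1 + (1 : Matrix (Fin d) (Fin d) ℝ)) = (2 : ℝ) • 1 := by rw [two_smul]
  have hz : (0 : PSDCone d).1 = 0 := rfl
  rw [laplaceTransform, integral_dirac' _ _ hc.stronglyMeasurable] at h1
  have hinv : ((2 : ℝ) • (1 : Matrix (Fin d) (Fin d) ℝ))⁻¹ = (2⁻¹ : ℝ) • 1 :=
    Matrix.inv_eq_left_inv (by simp [smul_smul])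
  simp only [hz, wishartLaplace, PSDCone.one, Matrix.mul_zero, Matrix.trace_zero, neg_zero,
    Real.exp_zero, Matrix.one_mul, h2, hinv, Matrix.det_smul, Matrix.det_one, Fintype.card_fin,
    mul_one, Matrix.smul_mul, Matrix.trace_smul, smul_eq_mul] at h1
  have htr := ω.2.trace_nonneg
  have hb : (1 : ℝ) < 2 ^ d := one_lt_pow₀ (by norm_num) (by omega)
  have he : Real.exp (-(2⁻¹ * ω.1.trace)) ≤ 1 := Real.exp_le_one_iff.mpr (by linarith)
  rcases hp.eq_or_lt with hp0 | hp0
  · subst hp0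
    rw [neg_zero, Real.rpow_zero, one_mul, eq_comm, Real.exp_eq_one_iff] at h1
    exact hpω rfl (Subtype.ext (ω.2.trace_eq_zero_iff.mp (by linarith)))
  · have := Real.rpow_lt_one_of_one_lt_of_neg hb (neg_lt_zero.mpr hp0)
    have h3 := Real.rpow_pos_of_pos (zero_lt_one.trans hb) (-p)
    nlinarith [Real.exp_pos (-(2⁻¹ * ω.1.trace))]

/-- The half-line as the cone of positive semidefinite `1 × 1` matrices. -/
def PSDCone.ofReal (x : ℝ) : PSDCone 1 :=
  ⟨Matrix.diagonal fun _ => max x 0, Matrix.PosSemidef.diagonal fun _ => le_max_right x 0⟩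

theorem PSDCone.measurable_ofReal : Measurable PSDCone.ofReal := by
  refine Continuous.measurable ?_
  unfold PSDCone.ofReal
  fun_prop

theorem isNoncentralWishart_one_of_noncentralGamma {p : ℝ} (hp : 0 ≤ p) (ω : PSDCone 1) :
    IsNoncentralWishart p ω (PSDCone.one 1)
      ((noncentralGamma p (ω.1 0 0).toNNReal).map PSDCone.ofReal) := by
  have hlap : ∀ u : PSDCone 1, wishartLaplace p ω (PSDCone.one 1) u =
      (1 + u.1 0 0) ^ (-p) * Real.exp (-(u.1 0 0 * ω.1 0 0 / (1 + u.1 0 0))) := by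
    intro u
    simp only [wishartLaplace, PSDCone.one, Matrix.one_mul, Matrix.det_fin_one, Matrix.add_apply,
      Matrix.one_apply_eq, Matrix.trace_fin_one, Matrix.mul_apply,
      Matrix.inv_def, Matrix.adjugate_fin_one, Matrix.smul_apply, Ring.inverse_eq_inv',
      smul_eq_mul, mul_one, Finset.univ_unique, Finset.sum_singleton, Fin.default_eq_zero]
    congr 3
    ring
  have hent : ∀ u : PSDCone 1, 0 ≤ u.1 0 0 := fun u => u.2.diag_nonneg
  refine .ext_lintegral (fun u => ?_) fun u => ?_
  · have hc : Continuous fun ξ : PSDCone 1 => ENNReal.ofReal (Real.exp (-(u.1 * ξ.1).trace)) :=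
      ENNReal.continuous_ofReal.comp (by fun_prop)
    rw [lintegral_map hc.measurable PSDCone.measurable_ofReal, hlap]
    have hw : ω.1 0 0 = (ω.1 0 0).toNNReal := (Real.coe_toNNReal _ (hent ω)).symm
    conv_rhs => rw [hw, ← lintegral_exp_neg_noncentralGamma _ hp (hent u)]
    refine lintegral_congr_ae ?_
    filter_upwards [noncentralGamma_ae_nonneg p (ω.1 0 0).toNNReal] with x hx
    simp [PSDCone.ofReal, Matrix.trace_fin_one, hx]
  · have := hent u
    rw [hlap]
    positivity

theorem Matrix.posSemidef_fin_two_of {a b c : ℝ} (ha : 0 ≤ a) (hc : 0 ≤ c) (h : b ^ 2 ≤ a * c) :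
    Matrix.PosSemidef !![a, b; b, c] := by
  refine .of_dotProduct_mulVec_nonneg ?_ fun v => ?_
  · ext i j; fin_cases i <;> fin_cases j <;> rfl
  · simp only [dotProduct, Matrix.mulVec, Fin.sum_univ_two, star_trivial, Matrix.of_apply,
      Matrix.cons_val', Matrix.cons_val_zero, Matrix.cons_val_one, Matrix.cons_val_fin_one]
    rcases ha.eq_or_lt with rfl | ha
    · have : b = 0 := by nlinarith
      subst this
      nlinarith [mul_nonneg hc (sq_nonneg (v 1))]
    -- `a` times the form is `(a v₀ + b v₁)² + (ac - b²) v₁²`.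
    · have : 0 ≤ a * (v 0 * (a * v 0 + b * v 1) + v 1 * (b * v 0 + c * v 1)) := by
        nlinarith [sq_nonneg (a * v 0 + b * v 1), mul_nonneg (sub_nonneg.mpr h) (sq_nonneg (v 1))]
      exact nonneg_of_mul_nonneg_right this ha

theorem PSDCone.exists_eq_of_fin_two (u : PSDCone 2) :
    ∃ a b c : ℝ, 0 ≤ a ∧ 0 ≤ c ∧ b ^ 2 ≤ a * c ∧ u.1 = !![a, b; b, c] := by
  have hs : u.1 1 0 = u.1 0 1 := u.2.1.apply 0 1
  refine ⟨u.1 0 0, u.1 0 1, u.1 1 1, u.2.diag_nonneg, u.2.diag_nonneg, ?_, ?_⟩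
  · have := u.2.det_nonneg
    rw [Matrix.det_fin_two, hs] at this
    nlinarith
  · conv_lhs => rw [Matrix.eta_fin_two u.1, hs]

/-- Since `u(I + u)⁻¹ = I - (I + u)⁻¹`, the exponent is `tr((I + u)⁻¹ ω) - tr ω`. -/
theorem wishartLaplace_one_fin_two (p : ℝ) {ω u : PSDCone 2} {a b c x y z : ℝ}
    (ha : 0 ≤ a) (hc : 0 ≤ c) (hb : b ^ 2 ≤ a * c)
    (hu : u.1 = !![a, b; b, c]) (hω : ω.1 = !![x, y; y, z]) :
    wishartLaplace p ω (PSDCone.one 2) u = ((1 + a) * (1 + c) - b ^ 2) ^ (-p) *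
      Real.exp (((1 + c) * x - 2 * b * y + (1 + a) * z) / ((1 + a) * (1 + c) - b ^ 2)
        - (x + z)) := by
  have hD : 0 < (1 + a) * (1 + c) - b ^ 2 := by nlinarith
  have h1 : (1 + (PSDCone.one 2).1 * u.1) = !![1 + a, b; b, 1 + c] := by
    rw [hu]
    simp only [PSDCone.one, Matrix.one_mul]
    ext i j; fin_cases i <;> fin_cases j <;> simp
  have hdet : (!![1 + a, b; b, 1 + c] : Matrix (Fin 2) (Fin 2) ℝ).det =
      (1 + a) * (1 + c) - b ^ 2 := by
    rw [Matrix.det_fin_two_of]; ring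
  rw [wishartLaplace, h1, hdet, Matrix.inv_def, hdet, Matrix.adjugate_fin_two_of, hu, hω]
  congr 2
  simp only [Ring.inverse_eq_inv', Matrix.trace_fin_two, Matrix.mul_apply, Fin.sum_univ_two,
    Matrix.smul_apply, Matrix.of_apply, Matrix.cons_val', Matrix.cons_val_zero,
    Matrix.cons_val_one, Matrix.cons_val_fin_one, smul_eq_mul]
  field_simp
  ring

/-- The Laplace transform of the last column after noise has been added in one coordinate
direction. -/
theorem lintegral_exp_neg_noncentralGamma_gaussianReal {p c : ℝ} (hp : 1 / 2 ≤ p) (hc : 0 ≤ c)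
    (w : ℝ≥0) (q b : ℝ) :
    ∫⁻ s, ∫⁻ x, ENNReal.ofReal
        (Real.exp (-(c * (max s 0 + (q + x) ^ 2) + 2 * b * (q + x))))
        ∂gaussianReal 0 (1 / 2) ∂noncentralGamma (p - 1 / 2) w =
      ENNReal.ofReal ((1 + c) ^ (-p) *
        Real.exp ((-(c * w) + (q - b) ^ 2) / (1 + c) - q ^ 2)) := by
  have hc' : 0 < 1 + c := by linarith
  have h1 : ∀ s : ℝ, ∫⁻ x, ENNReal.ofReal
        (Real.exp (-(c * (max s 0 + (q + x) ^ 2) + 2 * b * (q + x)))) ∂gaussianReal 0 (1 / 2) =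
      ENNReal.ofReal (Real.exp (-(c * max s 0))) * ENNReal.ofReal
        ((1 + c) ^ (-(1 / 2 : ℝ)) * Real.exp ((q - b) ^ 2 / (1 + c) - q ^ 2)) := by
    intro s
    rw [← lintegral_exp_neg_gaussianReal hc, ← lintegral_const_mul _ (by fun_prop)]
    refine lintegral_congr fun x => ?_
    rw [← ENNReal.ofReal_mul (Real.exp_pos _).le, ← Real.exp_add]
    congr 2
    ring
  simp_rw [h1]
  rw [lintegral_mul_const _ (by fun_prop)]
  have h2 : ∫⁻ s, ENNReal.ofReal (Real.exp (-(c * max s 0))) ∂noncentralGamma (p - 1 / 2) w =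
      ∫⁻ s, ENNReal.ofReal (Real.exp (-(c * s))) ∂noncentralGamma (p - 1 / 2) w := by
    refine lintegral_congr_ae ?_
    filter_upwards [noncentralGamma_ae_nonneg (p - 1 / 2) w] with s hs
    rw [max_eq_left hs]
  rw [h2, lintegral_exp_neg_noncentralGamma w (by linarith) hc,
    ← ENNReal.ofReal_mul (by positivity)]
  congr 1
  -- The gamma shape `p - 1/2` and the Gaussian exponent `1/2` add up to `p`.
  rw [show ∀ a b c d : ℝ, a * b * (c * d) = (a * c) * (b * d) by intros; ring, ← Real.exp_add,
    ← Real.rpow_add hc']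
  congr 2
  · ring
  · ring

/-- The positive semidefinite matrix with first column `r • (r, g)` and Schur complement
`max s 0`. -/
def PSDCone.ofSchur (s r g : ℝ) : PSDCone 2 :=
  ⟨!![r ^ 2, r * g; r * g, max s 0 + g ^ 2],
    Matrix.posSemidef_fin_two_of (sq_nonneg r) (add_nonneg (le_max_right s 0) (sq_nonneg g)) (by
      nlinarith [mul_nonneg (sq_nonneg r) (le_max_right s 0)])⟩

theorem PSDCone.measurable_ofSchur :
    Measurable fun v : ℝ × ℝ × ℝ => PSDCone.ofSchur v.1 v.2.1 v.2.2 := by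
  refine Continuous.measurable ?_
  unfold PSDCone.ofSchur
  refine Continuous.subtype_mk ?_ _
  refine continuous_matrix fun i j => ?_
  fin_cases i <;> fin_cases j <;> simp <;> fun_prop

/-- The transition kernel of the Schur complement in the second coordinate direction. -/
def schurKernel (p q z : ℝ) : Kernel (ℝ × ℝ) ℝ where
  toFun v := noncentralGamma (p - 1 / 2)
    (z - (√z * (q + v.2) / √(max v.1 0 + (q + v.2) ^ 2)) ^ 2).toNNReal
  measurable' := (measurable_noncentralGamma _).comp (by fun_prop)

theorem exists_isNoncentralWishart_fin_two {p : ℝ} (hp : 1 / 2 ≤ p) (ω : PSDCone 2) :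
    ∃ μ : Measure (PSDCone 2), IsNoncentralWishart p ω (PSDCone.one 2) μ := by
  obtain ⟨x, y, z, hx, hz, hyz, hω⟩ := ω.exists_eq_of_fin_two
  have hp' : 0 ≤ p - 1 / 2 := by linarith
  -- `ω` has entries `w + q²`, `√z q`, `z`, with `w` the Schur complement of `z`. If `z = 0` then `y
  -- = 0`, and division by zero gives the right value `q = 0`.
  obtain ⟨q, hq⟩ : ∃ q, q = y / √z := ⟨_, rfl⟩
  have hrr : √z ^ 2 = z := Real.sq_sqrt hz
  have hrq : √z * q = y := by
    rcases hz.eq_or_lt with rfl | hz'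
    · have : y = 0 := by nlinarith
      simp [this]
    · rw [hq, mul_div_cancel₀ _ (Real.sqrt_pos.mpr hz').ne']
  have hqx : q ^ 2 ≤ x := by
    rcases hz.eq_or_lt with rfl | hz'
    · simpa [hq] using hx
    · rw [hq, div_pow, hrr, div_le_iff₀ hz']
      exact hyz
  obtain ⟨w, hw⟩ : ∃ w : ℝ≥0, (w : ℝ) = x - q ^ 2 := ⟨⟨_, sub_nonneg.mpr hqx⟩, rfl⟩
  have : IsProbabilityMeasure (noncentralGamma (p - 1 / 2) w) :=
    isProbabilityMeasure_noncentralGamma hp' w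
  have : IsMarkovKernel (schurKernel p q z) :=
    ⟨fun v => isProbabilityMeasure_noncentralGamma hp' _⟩
  let γ := gaussianReal 0 (1 / 2)
  -- The first transition yields the matrix with diagonal `r²`, `z` and off-diagonal entry `√z (q +
  -- g)`; the second keeps `r²` and moves the rest.
  let F : ((ℝ × ℝ) × ℝ) × ℝ → PSDCone 2 := fun v =>
    let r := √(max v.1.1.1 0 + (q + v.1.1.2) ^ 2)
    PSDCone.ofSchur v.1.2 r (√z * (q + v.1.1.2) / r + v.2)
  have hF : Measurable F := by
    have h : Measurable fun v : ((ℝ × ℝ) × ℝ) × ℝ =>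
        (v.1.2, √(max v.1.1.1 0 + (q + v.1.1.2) ^ 2),
          √z * (q + v.1.1.2) / √(max v.1.1.1 0 + (q + v.1.1.2) ^ 2) + v.2) := by fun_prop
    exact PSDCone.measurable_ofSchur.comp h
  refine ⟨((((noncentralGamma (p - 1 / 2) w).prod γ).compProd (schurKernel p q z)).prod γ).map F,
    .ext_lintegral (fun u => ?_) fun u => ?_⟩
  · obtain ⟨a, b, c, ha, hc, hb, hu⟩ := u.exists_eq_of_fin_two
    have hc' : 0 < 1 + c := by linarith
    have hcont : Continuous fun ξ : PSDCone 2 =>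
      ENNReal.ofReal (Real.exp (-(u.1 * ξ.1).trace)) :=
        ENNReal.continuous_ofReal.comp (by fun_prop)
    have hm : Measurable fun v => ENNReal.ofReal (Real.exp (-(u.1 * (F v).1).trace)) :=
      hcont.measurable.comp hF
    have hA : 0 ≤ a - b ^ 2 / (1 + c) := by
      rw [sub_nonneg, div_le_iff₀ hc']; nlinarith
    -- Integrating out the second transition replaces `u` by `u(I + diag(0,1) u)⁻¹`, whose entries
    -- are `a - b²/(1+c)`, `b/(1+c)`, `c/(1+c)`.
    have hstep : ∀ s g : ℝ, ∫⁻ s', ∫⁻ g', ENNReal.ofReal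
          (Real.exp (-(u.1 * (F (((s, g), s'), g')).1).trace)) ∂γ ∂schurKernel p q z (s, g) =
        ENNReal.ofReal ((1 + c) ^ (-p) * Real.exp (-(c * z / (1 + c)))) * ENNReal.ofReal
          (Real.exp (-((a - b ^ 2 / (1 + c)) * (max s 0 + (q + g) ^ 2) +
            2 * (b * √z / (1 + c)) * (q + g)))) := by
      intro s g
      obtain ⟨R, hR⟩ : ∃ R, R = max s 0 + (q + g) ^ 2 := ⟨_, rfl⟩
      have hms : 0 ≤ max s 0 := le_max_right s 0
      have hR0 : 0 ≤ R := by rw [hR]; positivity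
      have hR2 : √R ^ 2 = R := Real.sq_sqrt hR0
      obtain ⟨k, hk⟩ : ∃ k, k = √z * (q + g) / √R := ⟨_, rfl⟩
      -- If `R = 0` then `q + g = 0`, so the default value `k = 0` is harmless.
      have hRk : √R * k = √z * (q + g) := by
        rcases hR0.eq_or_lt with h0 | h0
        · have : q + g = 0 := by
            have := sq_nonneg (q + g)
            exact pow_eq_zero_iff two_ne_zero |>.mp (by linarith)
          simp [this, ← h0]
        · rw [hk, mul_div_cancel₀ _ (Real.sqrt_pos.mpr h0).ne']
      have hkz : k ^ 2 ≤ z := by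
        rw [hk, div_pow, mul_pow, hrr, hR2]
        refine div_le_of_le_mul₀ hR0 hz ?_
        exact mul_le_mul_of_nonneg_left (by linarith) hz
      have hker : schurKernel p q z (s, g) =
          noncentralGamma (p - 1 / 2) (z - k ^ 2).toNNReal := by
        rw [hk, hR]; rfl
      have htr : ∀ s' g', -(u.1 * (F (((s, g), s'), g')).1).trace =
          -(a * R) + -(c * (max s' 0 + (k + g') ^ 2) + 2 * (b * √R) * (k + g')) := by
        intro s' g'
        have hval : (F (((s, g), s'), g')).1 =
            !![√R ^ 2, √R * (k + g'); √R * (k + g'), max s' 0 + (k + g') ^ 2] := by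
          rw [hk, hR]; rfl
        rw [hval, hu, hR2]
        simp only [Matrix.trace_fin_two, Matrix.mul_apply, Fin.sum_univ_two, Matrix.of_apply,
          Matrix.cons_val', Matrix.cons_val_zero, Matrix.cons_val_one, Matrix.cons_val_fin_one]
        ring
      have hlin := lintegral_exp_neg_noncentralGamma_gaussianReal hp hc (z - k ^ 2).toNNReal k
        (b * √R)
      rw [hker]
      simp_rw [htr, Real.exp_add, ENNReal.ofReal_mul (Real.exp_pos _).le]
      simp_rw [lintegral_const_mul' _ _ ENNReal.ofReal_ne_top]
      rw [hlin, ← ENNReal.ofReal_mul (by positivity), ← ENNReal.ofReal_mul (by positivity), ← hR,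
        Real.coe_toNNReal _ (sub_nonneg.mpr hkz),
        show ∀ a b c : ℝ, a * (b * c) = b * (a * c) by intros; ring, mul_assoc, ← Real.exp_add,
        ← Real.exp_add]
      congr 3
      field_simp
      linear_combination (b ^ 2) * hR2 - 2 * b * hRk
    rw [lintegral_map hcont.measurable hF, lintegral_prod _ hm.aemeasurable,
      Measure.lintegral_compProd (Measurable.lintegral_prod_right hm),
      lintegral_prod _ (Measurable.lintegral_kernel_prod_right
        (Measurable.lintegral_prod_right hm)).aemeasurable]
    simp_rw [hstep]
    simp_rw [lintegral_const_mul' _ _ ENNReal.ofReal_ne_top]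
    rw [lintegral_exp_neg_noncentralGamma_gaussianReal hp hA, ← ENNReal.ofReal_mul (by positivity),
      wishartLaplace_one_fin_two p ha hc hb hu hω]
    have hD : (1 + a) * (1 + c) - b ^ 2 = (1 + c) * (1 + (a - b ^ 2 / (1 + c))) := by
      field_simp; ring
    have hD0 : 0 < (1 + a) * (1 + c) - b ^ 2 := by nlinarith
    have hA' : 1 + (a - b ^ 2 / (1 + c)) = ((1 + a) * (1 + c) - b ^ 2) / (1 + c) := by
      rw [hD]; field_simp
    congr 1
    conv_rhs => rw [hD, Real.mul_rpow hc'.le (by linarith), ← hD]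
    rw [show ∀ a b c d : ℝ, a * b * (c * d) = (a * c) * (b * d) by intros; ring, ← Real.exp_add,
      hA', hw]
    congr 2
    have hne : (1 + c) * (1 + a) - b ^ 2 ≠ 0 := by
      rw [mul_comm]
      exact hD0.ne'
    field_simp
    rw [← hrq]
    linear_combination b ^ 2 * hrr
  · obtain ⟨a, b, c, ha, hc, hb, hu⟩ := u.exists_eq_of_fin_two
    rw [wishartLaplace_one_fin_two p ha hc hb hu hω]
    have : 0 < (1 + a) * (1 + c) - b ^ 2 := by nlinarith
    positivity

/-! ### Necessity -/

/-- The second moment is the second derivative of the moment generating function at `0`, and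
`(e^g)'' = (g'' + g'²) e^g`. -/
theorem integral_sq_of_mgf_eq_exp {Ω : Type*} [MeasurableSpace Ω] {ν : Measure Ω} {X : Ω → ℝ}
    {δ : ℝ} (hδ : 0 < δ) {g g₁ : ℝ → ℝ} {g₂ : ℝ}
    (hmgf : ∀ s ∈ Set.Ioo (-δ) δ, mgf X ν s = Real.exp (g s))
    (hg : ∀ s ∈ Set.Ioo (-δ) δ, HasDerivAt g (g₁ s) s) (hg₁ : HasDerivAt g₁ g₂ 0) :
    Integrable (fun ξ => X ξ ^ 2) ν ∧
      ∫ ξ, X ξ ^ 2 ∂ν = (g₂ + g₁ 0 ^ 2) * Real.exp (g 0) := by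
  -- A non-integrable exponential would have integral `0` by convention, which is not an
  -- exponential.
  have hsub : Set.Ioo (-δ) δ ⊆ integrableExpSet X ν := fun s hs => by
    by_contra hni
    have h0 : mgf X ν s = 0 := integral_undef hni
    rw [hmgf s hs] at h0
    exact (Real.exp_pos _).ne' h0
  have h0 : (0 : ℝ) ∈ Set.Ioo (-δ) δ := ⟨neg_lt_zero.mpr hδ, hδ⟩
  have hexp : (0 : ℝ) ∈ interior (integrableExpSet X ν) :=
    interior_mono hsub (by rwa [interior_Ioo])
  refine ⟨integrable_pow_of_mem_interior_integrableExpSet hexp 2, ?_⟩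
  have h2 := iteratedDeriv_mgf_zero hexp 2
  have hnhds : ∀ s ∈ Set.Ioo (-δ) δ, mgf X ν =ᶠ[nhds s] fun s => Real.exp (g s) := fun s hs =>
    Filter.eventuallyEq_of_mem (isOpen_Ioo.mem_nhds hs) hmgf
  have hd : deriv (mgf X ν) =ᶠ[nhds 0] fun s => Real.exp (g s) * g₁ s := by
    refine Filter.eventuallyEq_of_mem (isOpen_Ioo.mem_nhds h0) fun s hs => ?_
    rw [(hnhds s hs).deriv_eq]
    exact (hg s hs).exp.deriv
  have hprod : HasDerivAt (fun s => Real.exp (g s) * g₁ s)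
      (Real.exp (g 0) * g₁ 0 * g₁ 0 + Real.exp (g 0) * g₂) 0 := (hg 0 h0).exp.mul hg₁
  rw [iteratedDeriv_succ, iteratedDeriv_one, hd.deriv_eq, hprod.deriv] at h2
  simp only [Pi.pow_apply] at h2
  rw [← h2]
  ring

/-- The measure with density `exp (-t tr ξ)` with respect to `μ`. -/
def traceTilt {d : ℕ} (μ : Measure (PSDCone d)) (t : ℝ) : Measure (PSDCone d) :=
  μ.withDensity fun ξ => ENNReal.ofReal (Real.exp (-(t * ξ.1.trace)))

/-- For `t > 0` the point `tI` is interior to the cone, so `tI - sE` stays in the cone for small `s`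
of both signs when `E` is symmetric. -/
theorem mgf_traceTilt {d : ℕ} (μ : Measure (PSDCone d)) (t s : ℝ)
    (E : Matrix (Fin d) (Fin d) ℝ) (u : PSDCone d) (hu : u.1 = t • 1 - s • E) :
    mgf (fun ξ : PSDCone d => (E * ξ.1).trace) (traceTilt μ t) s = laplaceTransform μ u := by
  have hc : Continuous fun ξ : PSDCone d => ENNReal.ofReal (Real.exp (-(t * ξ.1.trace))) :=
    ENNReal.continuous_ofReal.comp (by fun_prop)
  rw [mgf, traceTilt, integral_withDensity_eq_integral_toReal_smul hc.measurable
    (ae_of_all _ fun _ => ENNReal.ofReal_lt_top), laplaceTransform]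
  refine integral_congr_ae (ae_of_all _ fun ξ => ?_)
  simp only [ENNReal.toReal_ofReal (Real.exp_pos _).le, smul_eq_mul, ← Real.exp_add, hu]
  congr 1
  simp [Matrix.sub_mul]
  ring

theorem IsNoncentralWishart.integral_trace_sq {p : ℝ} {ω : PSDCone 2} {μ : Measure (PSDCone 2)}
    (h : IsNoncentralWishart p ω (PSDCone.one 2) μ) {x y z : ℝ} (hω : ω.1 = !![x, y; y, z])
    {t : ℝ} (ht : 0 < t) :
    Integrable (fun ξ : PSDCone 2 => ((1 : Matrix (Fin 2) (Fin 2) ℝ) * ξ.1).trace ^ 2)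
        (traceTilt μ t) ∧
      ∫ ξ, ((1 : Matrix (Fin 2) (Fin 2) ℝ) * ξ.1).trace ^ 2 ∂traceTilt μ t =
        (2 * p / (1 + t) ^ 2 + 2 * (x + z) / (1 + t) ^ 3 +
          (2 * p / (1 + t) + (x + z) / (1 + t) ^ 2) ^ 2) *
        Real.exp (-p * Real.log ((1 + t) ^ 2) + (x + z) / (1 + t) - (x + z)) := by
  have key := integral_sq_of_mgf_eq_exp (ν := traceTilt μ t)
    (X := fun ξ : PSDCone 2 => ((1 : Matrix (Fin 2) (Fin 2) ℝ) * ξ.1).trace) ht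
    (g := fun s => -p * Real.log ((1 + t - s) ^ 2) + (x + z) / (1 + t - s) - (x + z))
    (g₁ := fun s => 2 * p / (1 + t - s) + (x + z) / (1 + t - s) ^ 2)
    (g₂ := 2 * p / (1 + t) ^ 2 + 2 * (x + z) / (1 + t) ^ 3) ?_ ?_ ?_
  · simpa using key
  · rintro s ⟨hs1, hs2⟩
    have hc : 0 ≤ t - s := by linarith
    have hpos : 0 < 1 + t - s := by linarith
    have hb : (0 : ℝ) ^ 2 ≤ (t - s) * (t - s) := by nlinarith
    rw [mgf_traceTilt μ t s 1 ⟨!![t - s, 0; 0, t - s], Matrix.posSemidef_fin_two_of hc hc hb⟩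
      (by ext i j; fin_cases i <;> fin_cases j <;> simp), h.laplaceTransform_eq,
      wishartLaplace_one_fin_two p hc hc hb rfl hω, Real.rpow_def_of_pos (by nlinarith),
      ← Real.exp_add]
    congr 1
    rw [show (1 + (t - s)) * (1 + (t - s)) - 0 ^ 2 = (1 + t - s) ^ 2 by ring]
    field_simp
    ring
  · rintro s ⟨hs1, hs2⟩
    have hpos : 0 < 1 + t - s := by linarith
    have h1 : HasDerivAt (fun s => 1 + t - s) (-1) s := by
      simpa using (hasDerivAt_id s).const_sub (1 + t)
    refine HasDerivAt.congr_deriv (((((h1.pow 2).log (pow_pos hpos 2).ne').const_mul (-p)).add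
      ((hasDerivAt_const s (x + z)).div h1 hpos.ne')).sub_const (x + z)) ?_
    simp only [Pi.pow_apply]
    field_simp
    ring
  · have h1 : HasDerivAt (fun s : ℝ => 1 + t - s) (-1) 0 := by
      simpa using (hasDerivAt_id (0 : ℝ)).const_sub (1 + t)
    have hpos : 0 < 1 + t := by linarith
    have hne : 1 + t - 0 ≠ 0 := by simpa using hpos.ne'
    refine HasDerivAt.congr_deriv (((hasDerivAt_const 0 (2 * p)).div h1 hne).add
      ((hasDerivAt_const 0 (x + z)).div (h1.pow 2) (pow_ne_zero 2 hne))) ?_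
    simp only [sub_zero]
    field_simp
    ring

/-- The symmetric matrix `E` with rows `(α, β)`, `(β, -α)` has eigenvalues `±1`, so `tI - sE` is in
the cone for `|s| ≤ t` and `det((1 + t)I - sE) = (1 + t)² - s²`. -/
theorem IsNoncentralWishart.integral_trace_mul_sq {p : ℝ} {ω : PSDCone 2}
    {μ : Measure (PSDCone 2)} (h : IsNoncentralWishart p ω (PSDCone.one 2) μ) {x y z : ℝ}
    (hω : ω.1 = !![x, y; y, z]) {t : ℝ} (ht : 0 < t) {α β : ℝ} (hαβ : α ^ 2 + β ^ 2 = 1) :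
    Integrable (fun ξ : PSDCone 2 => (!![α, β; β, -α] * ξ.1).trace ^ 2) (traceTilt μ t) ∧
      ∫ ξ, (!![α, β; β, -α] * ξ.1).trace ^ 2 ∂traceTilt μ t =
        (2 * p / (1 + t) ^ 2 + 2 * (x + z) / (1 + t) ^ 3 +
          ((α * (x - z) + 2 * β * y) / (1 + t) ^ 2) ^ 2) *
        Real.exp (-p * Real.log ((1 + t) ^ 2) + (x + z) / (1 + t) - (x + z)) := by
  obtain ⟨e, he⟩ : ∃ e, e = α * (x - z) + 2 * β * y := ⟨_, rfl⟩
  have hDpos : ∀ s ∈ Set.Ioo (-t) t, 0 < (1 + t) ^ 2 - s ^ 2 := by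
    rintro s ⟨hs1, hs2⟩
    nlinarith
  have hD : ∀ s : ℝ, HasDerivAt (fun s => (1 + t) ^ 2 - s ^ 2) (-(2 * s)) s := fun s => by
    simpa using (hasDerivAt_pow 2 s).const_sub ((1 + t) ^ 2)
  have hN : ∀ s : ℝ, HasDerivAt (fun s => (1 + t) * (x + z) + s * e) e s := fun s => by
    simpa using ((hasDerivAt_id s).mul_const e).const_add ((1 + t) * (x + z))
  have hpos : 0 < 1 + t := by linarith
  have key := integral_sq_of_mgf_eq_exp (ν := traceTilt μ t)
    (X := fun ξ : PSDCone 2 => (!![α, β; β, -α] * ξ.1).trace) ht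
    (g := fun s => -p * Real.log ((1 + t) ^ 2 - s ^ 2) +
      ((1 + t) * (x + z) + s * e) / ((1 + t) ^ 2 - s ^ 2) - (x + z))
    (g₁ := fun s => 2 * p * s / ((1 + t) ^ 2 - s ^ 2) + e / ((1 + t) ^ 2 - s ^ 2) +
      ((1 + t) * (x + z) + s * e) * (2 * s) / ((1 + t) ^ 2 - s ^ 2) ^ 2)
    (g₂ := 2 * p / (1 + t) ^ 2 + 2 * (x + z) / (1 + t) ^ 3) ?_ ?_ ?_
  · rw [← he]
    refine ⟨key.1, key.2.trans ?_⟩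
    congr 2
    · simp
    · congr 1
      simp only [zero_pow two_ne_zero, sub_zero, zero_mul, add_zero]
      field_simp
  · intro s hs
    have hDs := hDpos s hs
    obtain ⟨hs1, hs2⟩ := hs
    have hα : |α| ≤ 1 := abs_le_one_iff_mul_self_le_one.mpr (by nlinarith [sq_nonneg β])
    have hsα : |s * α| ≤ t := by
      rw [abs_mul]
      have : |s| ≤ t := abs_le.mpr ⟨hs1.le, hs2.le⟩
      nlinarith [abs_nonneg s, abs_nonneg α]
    obtain ⟨hl, hr⟩ := abs_le.mp hsα
    have ha : 0 ≤ t - s * α := by linarith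
    have hc : 0 ≤ t + s * α := by linarith
    have hb : (-(s * β)) ^ 2 ≤ (t - s * α) * (t + s * α) := by
      have : s ^ 2 * (α ^ 2 + β ^ 2) ≤ t ^ 2 := by rw [hαβ]; nlinarith
      nlinarith
    have hdet : (1 + (t - s * α)) * (1 + (t + s * α)) - (-(s * β)) ^ 2 =
        (1 + t) ^ 2 - s ^ 2 := by
      linear_combination -s ^ 2 * hαβ
    rw [mgf_traceTilt μ t s !![α, β; β, -α]
      ⟨!![t - s * α, -(s * β); -(s * β), t + s * α], Matrix.posSemidef_fin_two_of ha hc hb⟩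
      (by ext i j; fin_cases i <;> fin_cases j <;> simp), h.laplaceTransform_eq,
      wishartLaplace_one_fin_two p ha hc hb rfl hω, hdet, Real.rpow_def_of_pos hDs,
      ← Real.exp_add, he]
    congr 1
    field_simp
    ring
  · intro s hs
    have hDs := hDpos s hs
    refine HasDerivAt.congr_deriv ((((hD s).log hDs.ne').const_mul (-p)).add
      ((hN s).div (hD s) hDs.ne') |>.sub_const (x + z)) ?_
    field_simp
    ring
  · have hD0 : (1 + t) ^ 2 - (0 : ℝ) ^ 2 ≠ 0 := (hDpos 0 ⟨neg_lt_zero.mpr ht, ht⟩).ne'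
    have h1 : HasDerivAt (fun s : ℝ => 2 * p * s) (2 * p) 0 := by
      simpa using (hasDerivAt_id (0 : ℝ)).const_mul (2 * p)
    have h2 : HasDerivAt (fun s : ℝ => 2 * s) 2 0 := by
      simpa using (hasDerivAt_id (0 : ℝ)).const_mul 2
    refine HasDerivAt.congr_deriv
      (((h1.div (hD 0) hD0).add ((hasDerivAt_const (0 : ℝ) e).div (hD 0) hD0)).add
        (((hN 0).mul h2).div ((hD 0).pow 2) (pow_ne_zero 2 hD0))) ?_
    simp only [Pi.mul_apply, zero_pow two_ne_zero, sub_zero]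
    field_simp
    ring

/-- The positivity of `∫ det ξ exp (-t tr ξ) μ(dξ)`, written out. -/
theorem IsNoncentralWishart.det_moment_nonneg {p : ℝ} {ω : PSDCone 2} {μ : Measure (PSDCone 2)}
    (h : IsNoncentralWishart p ω (PSDCone.one 2) μ) {x y z : ℝ} (hω : ω.1 = !![x, y; y, z])
    {t : ℝ} (ht : 0 < t) :
    2 * (1 - 2 * p) * (p * (1 + t) + (x + z)) * (1 + t) ≤ (x + z) ^ 2 := by
  obtain ⟨i1, e1⟩ := h.integral_trace_sq hω ht
  obtain ⟨i2, e2⟩ := h.integral_trace_mul_sq hω ht (α := 1) (β := 0) (by norm_num)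
  obtain ⟨i3, e3⟩ := h.integral_trace_mul_sq hω ht (α := 0) (β := 1) (by norm_num)
  -- Pointwise this is `(ξ₁₁ - ξ₂₂)² + (2ξ₁₂)² ≤ (tr ξ)²`, that is, `det ξ ≥ 0`.
  have hle := integral_mono (i2.add i3) i1 (fun ξ => by
    obtain ⟨a, b, c, ha, hc, hb, hξ⟩ := ξ.exists_eq_of_fin_two
    simp only [Pi.add_apply, hξ, Matrix.one_mul, Matrix.trace_fin_two, Matrix.mul_apply,
      Fin.sum_univ_two, Matrix.of_apply, Matrix.cons_val', Matrix.cons_val_zero,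
      Matrix.cons_val_one, Matrix.cons_val_fin_one]
    nlinarith)
  simp only [Pi.add_apply] at hle
  rw [integral_add i2 i3, e1, e2, e3, ← add_mul] at hle
  have hle' := le_of_mul_le_mul_right hle (Real.exp_pos _)
  have hpos : 0 < 1 + t := by linarith
  have hs := mul_le_mul_of_nonneg_right hle' (by positivity : (0 : ℝ) ≤ (1 + t) ^ 4)
  field_simp at hs
  -- The term `(x - z)² + 4y²` on the smaller side is dropped.
  nlinarith [sq_nonneg (x - z), sq_nonneg y]

/-- The transform equals `1` at `u = I`, so the nonnegative function `1 - e^{-tr ξ}` has integral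
`0`; hence `tr ξ = 0`, and so `ξ = 0`, almost everywhere. -/
theorem IsNoncentralWishart.eq_dirac_zero {d : ℕ} {μ : Measure (PSDCone d)} {σ : PSDCone d}
    (h : IsNoncentralWishart 0 0 σ μ) : μ = Measure.dirac 0 := by
  have := h.isProbabilityMeasure
  have hz : (0 : PSDCone d).1 = 0 := rfl
  have h1 := h.laplaceTransform_eq (PSDCone.one d)
  simp only [laplaceTransform, wishartLaplace, hz, PSDCone.one, neg_zero, Real.rpow_zero,
    Matrix.mul_zero, Matrix.trace_zero, Real.exp_zero, mul_one, Matrix.one_mul] at h1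
  have hexp : Integrable (fun ξ : PSDCone d => Real.exp (-ξ.1.trace)) μ := by
    by_contra hni
    rw [integral_undef hni] at h1
    exact zero_ne_one h1
  have h2 : ∫ ξ : PSDCone d, (1 - Real.exp (-ξ.1.trace)) ∂μ = 0 := by
    rw [integral_sub (integrable_const _) hexp, h1]
    simp
  rw [integral_eq_zero_iff_of_nonneg (fun ξ => sub_nonneg.mpr
    (Real.exp_le_one_iff.mpr (neg_nonpos.mpr ξ.2.trace_nonneg)))
    ((integrable_const _).sub hexp)] at h2
  have h3 : (id : PSDCone d → PSDCone d) =ᵐ[μ] fun _ => 0 := by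
    filter_upwards [h2] with ξ hξ
    have : Real.exp (-ξ.1.trace) = 1 := (sub_eq_zero.mp hξ).symm
    rw [Real.exp_eq_one_iff, neg_eq_zero] at this
    exact Subtype.ext (ξ.2.trace_eq_zero_iff.mp this)
  rw [← Measure.map_id (μ := μ), Measure.map_congr h3, Measure.map_const]
  simp

theorem IsNoncentralWishart.half_le {p : ℝ} (hp : 0 ≤ p) {ω : PSDCone 2}
    {μ : Measure (PSDCone 2)} (h : IsNoncentralWishart p ω (PSDCone.one 2) μ)
    (hμ : μ ≠ Measure.dirac 0) : 1 / 2 ≤ p := by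
  by_contra! hlt
  obtain ⟨x, y, z, hx, hz, hyz, hω⟩ := ω.exists_eq_of_fin_two
  have hdet := fun {t : ℝ} (ht : 0 < t) => h.det_moment_nonneg hω ht
  have hq : 0 < 1 - 2 * p := by linarith
  rcases hp.eq_or_lt with rfl | hp0
  · have hw : x + z = 0 := by
      by_contra hne
      have hw : 0 < x + z := lt_of_le_of_ne (by linarith) (Ne.symm hne)
      -- With `t = x + z` the inequality reads `2t(1 + t) ≤ t²`.
      have := hdet hw
      nlinarith
    have hx0 : x = 0 := by linarith
    have hz0 : z = 0 := by linarith
    have hy0 : y = 0 := by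
      subst hx0
      nlinarith
    have hω0 : ω = 0 := by
      refine Subtype.ext (hω.trans ?_)
      rw [hx0, hy0, hz0]
      ext i j; fin_cases i <;> fin_cases j <;> rfl
    subst hω0
    exact hμ h.eq_dirac_zero
  · have hk : 0 < 2 * (1 - 2 * p) * p := by positivity
    -- With this `t`, the term of the left side linear in `t` already exceeds `(x + z)²`.
    have ht : 0 < ((x + z) ^ 2 + 1) / (2 * (1 - 2 * p) * p) := by positivity
    have h1 := hdet ht
    have h2 : 2 * (1 - 2 * p) * p * (((x + z) ^ 2 + 1) / (2 * (1 - 2 * p) * p)) =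
        (x + z) ^ 2 + 1 := mul_div_cancel₀ _ hk.ne'
    generalize ((x + z) ^ 2 + 1) / (2 * (1 - 2 * p) * p) = t at *
    have h3 : 0 ≤ 2 * (1 - 2 * p) * (x + z) * (1 + t) := by positivity
    nlinarith [mul_pos hk ht, mul_pos (mul_pos hk ht) ht]

end

theorem corollary3 (d : ℕ) (hd1 : 1 ≤ d) (hd2 : d ≤ 2) (p : ℝ) (hp : 0 ≤ p)
    (ω σ : PSDCone d) (hσ : IsUnit σ.1)
    (hpω : d = 1 → p = 0 → ω ≠ 0) :
    (∃ μ : Measure (PSDCone d), IsNoncentralWishart p ω σ μ ∧ μ ≠ Measure.dirac 0) ↔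
      p ∈ gindikinEnsemble d := by
  obtain ⟨ω', hω', hiff⟩ := exists_isNoncentralWishart_iff_one p ω σ hσ
  rw [hiff]
  obtain rfl | rfl : d = 1 ∨ d = 2 := by omega
  · rw [gindikinEnsemble_one]
    refine ⟨fun _ => hp, fun _ => ?_⟩
    have h := isNoncentralWishart_one_of_noncentralGamma hp ω'
    exact ⟨_, h, h.ne_dirac_zero le_rfl hp fun h0 => mt hω'.mp (hpω rfl h0)⟩
  · rw [gindikinEnsemble_two]
    refine ⟨fun ⟨μ, hμ, hne⟩ => hμ.half_le hp hne, fun hp2 => ?_⟩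
    have hp2' : 1 / 2 ≤ p := hp2
    obtain ⟨μ, hμ⟩ := exists_isNoncentralWishart_fin_two hp2' ω'
    exact ⟨μ, hμ, hμ.ne_dirac_zero hd1 hp fun h0 => by linarith⟩
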